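/- Let $m\ge 1$, let $F_m$ be the free group on letters $a_1,\dots,a_m$, and identify each element of $F_m$ with the reduced word over $\{a_1^{\pm1},\dots,a_m^{\pm1}\}$ representing it. Consider the following transformations of an $m$-tuple $(W_1,\dots,W_m)$ of elements of $F_m$: (T1) for some $i$, replace $W_i$ by $W_i^{-1}$; (T2) for some $i\ne j$, replace $W_i$ by the product $W_iW_j$ in $F_m$; (T3) for some $i$ and some $S\in F_m$, replace $W_i$ by $SW_iS^{-1}$; (T3C) for some $i$, replace $W_i$ by the element of $F_m$ represented by a cyclic permutation of the reduced word $W_i$. (a) If a pair $(R_1,R_2)$ of elements of $F_2$ can be transformed into $(a_1,a_2)$ by a finite sequence of transformations (T1), (T2), (T3), then it can be transformed into $(a_1,a_2)$ by a finite sequence of transformations (T1), (T2), (T3C). (b) Let $r\ge 2$ be an integer. Suppose that for every $m$ with $2\le m\le r$, every $m$-tuple $(R_1,\dots,R_m)$ of elements of $F_m$ such that the presentation $\langle a_1,\dots,a_m \,\|\, R_1,\dots,R_m\rangle$ defines the trivial group can be transformed into $(a_1,\dots,a_m)$ by a finite sequence of transformations (T1), (T2), (T3). Then for every $m$ with $2\le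 m\le r$, every $m$-tuple $(R_1,\dots,R_m)$ of elements of $F_m$ such that $\langle a_1,\dots,a_m \,\|\, R_1,\dots,R_m\rangle$ defines the trivial group can be transformed into $(a_1,\dots,a_m)$ by a finite sequence of transformations (T1), (T2), (T3C). -/

import Mathlib

/-- `WordTuple n m` is the type of `n`-tuples of elements of the free group on `m` letters. The
reduced word of an element `w` is `FreeGroup.toWord w`. -/
abbrev WordTuple (n m : ℕ) : Type := Fin n → FreeGroup (Fin m)

/-- The Nielsen transformations (T1) and (T2). -/
inductive NielsenStep {n m : ℕ} : WordTuple n m → WordTuple n m → Prop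
  /-- (T1): replace `W i` by its inverse. -/
  | inv (W : WordTuple n m) (i : Fin n) :
      NielsenStep W (Function.update W i (W i)⁻¹)
  /-- (T2): replace `W i` by `W i * W j`, where `i ≠ j`. -/
  | mul (W : WordTuple n m) (i j : Fin n) (hij : i ≠ j) :
      NielsenStep W (Function.update W i (W i * W j))

/-- Transformation (T3): replace some `W i` by a conjugate of it in the free group. -/
inductive ConjStep {n m : ℕ} : WordTuple n m → WordTuple n m → Prop
  | conj (W : WordTuple n m) (i : Fin n) (S : FreeGroup (Fin m)) :
      ConjStep W (Function.update W i (S * W i * S⁻¹))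

/-- Transformation (T3C): replace some `W i` by (the free group element given by) a cyclic
permutation `L` of the reduced word of `W i`. -/
inductive CyclicStep {n m : ℕ} : WordTuple n m → WordTuple n m → Prop
  | rotate (W : WordTuple n m) (i : Fin n) (L : List (Fin m × Bool))
      (hL : List.IsRotated (W i).toWord L) :
      CyclicStep W (Function.update W i (FreeGroup.mk L))

/-- The letter tuple `(a₁, …, aₘ)`. -/
def letterTuple (m : ℕ) : WordTuple m m := fun i => FreeGroup.of i

/-- `R` can be brought to `(a₁, …, aₘ)` by finitely many transformations (T1), (T2), (T3). -/
def IsACTrivialisable {m : ℕ} (R : WordTuple m m) : Prop :=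
  Relation.ReflTransGen (fun V W => NielsenStep V W ∨ ConjStep V W) R (letterTuple m)

/-- `R` can be brought to `(a₁, …, aₘ)` by finitely many transformations (T1), (T2), (T3C). -/
def IsCyclicallyACTrivialisable {m : ℕ} (R : WordTuple m m) : Prop :=
  Relation.ReflTransGen (fun V W => NielsenStep V W ∨ CyclicStep V W) R (letterTuple m)

/-- The balanced presentation `⟨a₁, …, aₘ ‖ R₁, …, Rₘ⟩` defines the trivial group. -/
def DefinesTrivialGroup {m : ℕ} (R : WordTuple m m) : Prop :=
  Subsingleton (PresentedGroup (Set.range R))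

/-! In every rank, (T3) can be traded for (T3C). Going back along a trivialising sequence from its
end, one shows that any tuple conjugate row by row to a term of it reaches the letters by (T1),
(T2), (T3C). Only (T2) is hard: row `i` must absorb a prescribed conjugate of row `j`, up to
conjugating rows.

A row can be conjugated by any letter occurring in another, cyclically reduced row
(`CyclicReach.conj_letter`), hence by anything if the other rows involve all letters. This settles
(T2) when row `i` or row `j` is free in this sense. Otherwise some letter `a` occurs only in row `i`
and some `b` only in row `j`. If every row has such a private letter, the abelianisation forces the
rows to be the letters up to order and inversion. If not, some third row `k` is free and avoids `a`
and `b`. It carries the conjugate of row `j` to row `i`, and `exists_occurs_mul_conj` keeps it free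
until it is restored (`CyclicReach.exists_mul_conj`). -/

namespace FreeGroup

variable {α : Type*}

/-! ### Reduced words and the letters that survive conjugation -/

theorem isCyclicallyReduced_iff_append_self {L : List (α × Bool)} :
    IsCyclicallyReduced L ↔ IsReduced (L ++ L) := by
  rw [isCyclicallyReduced_iff, IsReduced, IsReduced, List.isChain_append]
  tauto

theorem IsCyclicallyReduced.isRotated {L L' : List (α × Bool)} (h : IsCyclicallyReduced L)
    (hr : L.IsRotated L') : IsCyclicallyReduced L' := by
  have key : ∀ A B : List (α × Bool), IsCyclicallyReduced (A ++ B) →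
      IsCyclicallyReduced (B ++ A) := fun A B hAB => by
    rw [isCyclicallyReduced_iff_append_self]
    -- `BABA` is an infix of the reduced word `ABABAB`.
    exact (hAB.flatten_replicate 3).isReduced.infix ⟨A, B, by simp [List.replicate_succ]⟩
  obtain ⟨n, hn, rfl⟩ := List.isRotated_iff_mod.1 hr
  rw [List.rotate_eq_drop_append_take hn]
  exact key _ _ (by rwa [List.take_append_drop])

variable [DecidableEq α]

theorem mem_of_forall_mem_toWord {H : Subgroup (FreeGroup α)} {w : FreeGroup α}
    (h : ∀ p ∈ w.toWord, of p.1 ∈ H) : w ∈ H := by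
  have key : ∀ L : List (α × Bool), (∀ p ∈ L, of p.1 ∈ H) → mk L ∈ H := by
    intro L
    induction L with
    | nil => intro _; exact H.one_mem
    | cons p L ih =>
      intro hL
      rw [show mk (p :: L) = mk [p] * mk L by simp [mul_mk]]
      refine H.mul_mem ?_ (ih fun q hq => hL q (List.mem_cons_of_mem _ hq))
      have hp := hL p List.mem_cons_self
      obtain ⟨x, _ | _⟩ := p
      · exact H.inv_mem hp
      · exact hp
  rw [← mk_toWord (x := w)]
  exact key _ h

/-- The exponent sum of the letter `x`. -/
def expSum (x : α) : FreeGroup α →* Multiplicative ℤ :=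
  lift fun y => Multiplicative.ofAdd (if y = x then 1 else 0)

theorem expSum_of (x y : α) :
    expSum x (of y) = Multiplicative.ofAdd (if y = x then (1 : ℤ) else 0) := by
  simp [expSum]

theorem expSum_of_self_ne_one (x : α) : expSum x (of x) ≠ 1 := by
  rw [expSum_of, if_pos rfl]
  decide

theorem exists_mem_toWord_of_expSum_ne_one {x : α} {w : FreeGroup α} (h : expSum x w ≠ 1) :
    ∃ e, (x, e) ∈ w.toWord := by
  by_contra! hx
  refine h (MonoidHom.mem_ker.1 (mem_of_forall_mem_toWord fun p hp => ?_))
  have : p.1 ≠ x := by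
    rintro rfl
    exact hx p.2 hp
  rw [MonoidHom.mem_ker, expSum_of, if_neg this]
  rfl

/-- The letter `x` occurs, with some exponent, in the reduced word of every conjugate of `w`. -/
def Occurs (x : α) (w : FreeGroup α) : Prop :=
  ∀ g : FreeGroup α, ∃ e, (x, e) ∈ (g * w * g⁻¹).toWord

theorem Occurs.mem_toWord {x : α} {w : FreeGroup α} (h : Occurs x w) :
    ∃ e, (x, e) ∈ w.toWord := by simpa using h 1

theorem Occurs.conj {x : α} {w : FreeGroup α} (h : Occurs x w) (g : FreeGroup α) :
    Occurs x (g * w * g⁻¹) := fun k => by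
  simpa [mul_assoc] using h (k * g)

theorem Occurs.of_isConj {x : α} {w w' : FreeGroup α} (h : Occurs x w) (hc : IsConj w w') :
    Occurs x w' := by
  obtain ⟨g, rfl⟩ := isConj_iff.1 hc
  exact h.conj g

theorem occurs_of_expSum_ne_one {x : α} {w : FreeGroup α} (h : expSum x w ≠ 1) : Occurs x w :=
  fun g => exists_mem_toWord_of_expSum_ne_one (by simpa using h)

/-- If a conjugate of `w` omits `x`, so do its powers, and the number of `x` in `w ^ n` is bounded
by the conjugators; but `w ^ n` has at least `n` of them, as nothing cancels. -/
theorem occurs_of_mem_toWord {x : α} {w : FreeGroup α} (hw : IsCyclicallyReduced w.toWord)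
    {e : Bool} (hx : (x, e) ∈ w.toWord) : Occurs x w := by
  intro g
  by_contra! hg
  let c : List (α × Bool) → ℕ := List.countP fun p => decide (p.1 = x)
  have cmul : ∀ u v : FreeGroup α, c (u * v).toWord ≤ c u.toWord + c v.toWord := fun u v => by
    have := (toWord_mul_sublist u v).countP_le (p := fun p => decide (p.1 = x))
    rwa [List.countP_append] at this
  have hz : c (g * w * g⁻¹).toWord = 0 := by
    refine List.countP_eq_zero.2 fun p hp => ?_
    simp only [decide_eq_true_eq]
    rintro rfl
    exact hg p.2 hp
  have hpow : ∀ n : ℕ, c ((g * w * g⁻¹) ^ n).toWord = 0 := by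
    intro n
    induction n with
    | zero => simp [c]
    | succ n ih =>
      have := cmul ((g * w * g⁻¹) ^ n) (g * w * g⁻¹)
      rw [pow_succ]
      omega
  have hone : 1 ≤ c w.toWord := List.countP_pos_iff.2 ⟨_, hx, by simp⟩
  have hflat : ∀ n : ℕ, n ≤ c (w ^ n).toWord := by
    intro n
    rw [toWord_pow, (hw.flatten_replicate n).isReduced.reduce_eq]
    induction n with
    | zero => simp
    | succ n ih =>
      simp only [List.replicate_succ, List.flatten_cons, c, List.countP_append] at ih hone ⊢
      omega
  set N := c g⁻¹.toWord + c g.toWord + 1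
  have h1 := hflat N
  rw [show w ^ N = g⁻¹ * (g * w * g⁻¹) ^ N * g by rw [conj_pow]; group] at h1
  have h2 := cmul (g⁻¹ * (g * w * g⁻¹) ^ N) g
  have h3 := cmul g⁻¹ ((g * w * g⁻¹) ^ N)
  have h4 := hpow N
  omega

/-- Each letter of `u` cancels at most one letter of `B`. -/
theorem drop_isSuffix_reduce_append (u : List (α × Bool)) {B : List (α × Bool)}
    (hB : IsReduced B) : B.drop u.length <:+ reduce (u ++ B) := by
  induction u with
  | nil => simp [hB.reduce_eq]
  | cons y u ih =>
    rw [List.cons_append, reduce.cons, List.length_cons, ← List.drop_drop]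
    rcases hr : reduce (u ++ B) with _ | ⟨z, t⟩
    · rw [hr, List.suffix_nil] at ih
      simp [ih]
    · rw [hr, List.suffix_cons_iff] at ih
      have ht : (B.drop u.length).drop 1 <:+ t := by
        rcases ih with h | h
        · rw [h]
          exact List.suffix_refl _
        · exact (List.drop_suffix _ _).trans h
      simp only
      split
      · exact ht
      · exact ht.trans ⟨[y, z], rfl⟩

theorem length_le_and_getLast?_toWord_pow {w : FreeGroup α} {l : α × Bool}
    (hl : w.toWord.getLast? = some l) (n : ℕ) :
    n + 1 ≤ (w ^ (n + 1)).toWord.length ∧ (w ^ (n + 1)).toWord.getLast? = some l := by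
  have hdec := reduceCyclically.conj_conjugator_reduceCyclically w.toWord
  rw [toWord_pow, reduceCyclically.reduce_flatten_replicate_succ isReduced_toWord]
  set c := reduceCyclically.conjugator w.toWord
  set r := reduceCyclically w.toWord
  have hr : r ≠ [] := by
    intro h0
    have h1 : w = 1 := by
      rw [← mk_toWord (x := w), ← hdec, h0, List.append_nil, ← mul_mk, ← inv_mk, mul_inv_cancel]
    simp [h1] at hl
  have hpos : 1 ≤ r.length := List.length_pos_iff.2 hr
  constructor
  · simp only [List.length_append, List.length_flatten, List.map_replicate, List.sum_replicate,
      smul_eq_mul]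
    nlinarith
  · rw [← hdec] at hl
    rw [List.replicate_succ', List.flatten_concat]
    have : ∀ X : List (α × Bool),
        (X ++ (r ++ invRev c)).getLast? = (r ++ invRev c).getLast? := fun X =>
      List.getLast?_append_of_ne_nil _ (by simp [hr])
    simp only [List.append_assoc] at hl ⊢
    rw [← List.append_assoc c, this]
    rwa [this] at hl

/-- A power of `w` longer than `t` cannot be cancelled entirely by `t`, so its last letter survives.
-/
theorem exists_getLast?_toWord_mul_pow {w : FreeGroup α} {l : α × Bool}
    (hl : w.toWord.getLast? = some l) (t : FreeGroup α) :
    ∃ n : ℕ, (t * w ^ n).toWord.getLast? = some l := by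
  obtain ⟨h1, h2⟩ := length_le_and_getLast?_toWord_pow hl t.toWord.length
  refine ⟨t.toWord.length + 1, ?_⟩
  obtain ⟨X, hX⟩ := drop_isSuffix_reduce_append t.toWord
    (isReduced_toWord (x := w ^ (t.toWord.length + 1)))
  have hne : (w ^ (t.toWord.length + 1)).toWord.drop t.toWord.length ≠ [] := by
    rw [Ne, List.drop_eq_nil_iff]
    omega
  rw [toWord_mul, ← hX, List.getLast?_append_of_ne_nil _ hne, List.getLast?_drop,
    if_neg (by omega), h2]

/-- A cyclically reduced conjugate of `w`. -/
def cyclicReduction (w : FreeGroup α) : FreeGroup α := mk (reduceCyclically w.toWord)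

theorem toWord_cyclicReduction (w : FreeGroup α) :
    (cyclicReduction w).toWord = reduceCyclically w.toWord := by
  rw [cyclicReduction, toWord_mk,
    (reduceCyclically.isCyclicallyReduced isReduced_toWord).isReduced.reduce_eq]

theorem isCyclicallyReduced_cyclicReduction (w : FreeGroup α) :
    IsCyclicallyReduced (cyclicReduction w).toWord := by
  rw [toWord_cyclicReduction]
  exact reduceCyclically.isCyclicallyReduced isReduced_toWord

theorem exists_isRotated_cyclicReduction (w : FreeGroup α) :
    ∃ L, w.toWord.IsRotated L ∧ mk L = cyclicReduction w := by
  have hdec := reduceCyclically.conj_conjugator_reduceCyclically w.toWord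
  set c := reduceCyclically.conjugator w.toWord
  set r := reduceCyclically w.toWord with hr
  refine ⟨r ++ invRev c ++ c, ?_, ?_⟩
  · rw [← hdec, List.append_assoc]
    exact List.isRotated_append
  · rw [← mul_mk, ← mul_mk, ← inv_mk, cyclicReduction, ← hr]
    group

theorem isConj_cyclicReduction (w : FreeGroup α) : IsConj w (cyclicReduction w) := by
  have hdec := reduceCyclically.conj_conjugator_reduceCyclically w.toWord
  refine (isConj_iff.2 ⟨mk (reduceCyclically.conjugator w.toWord), ?_⟩).symm
  rw [cyclicReduction, inv_mk, mul_mk, mul_mk, hdec, mk_toWord]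

/-- If the word of `v` omits two letters, then `u` can be multiplied by a conjugate of `v` without
losing any letter. -/
theorem exists_occurs_mul_conj {u v : FreeGroup α} {a b : α} (hab : a ≠ b)
    (ha : ∀ e, (a, e) ∉ v.toWord) (hb : ∀ e, (b, e) ∉ v.toWord) :
    ∃ s : FreeGroup α, ∀ x, Occurs x u ∨ Occurs x v → Occurs x (u * (s * v * s⁻¹)) := by
  have one_not : ∀ x : α, ¬ Occurs x (1 : FreeGroup α) := fun x h => by
    obtain ⟨e, he⟩ := h.mem_toWord
    simp at he
  by_cases hu1 : u = 1
  · exact ⟨1, fun x hx => by simpa [hu1, one_not] using hx⟩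
  by_cases hv1 : v = 1
  · exact ⟨1, fun x hx => by simpa [hv1, one_not] using hx⟩
  rw [← toWord_eq_nil_iff] at hu1 hv1
  obtain ⟨p, U, hU⟩ := List.exists_cons_of_ne_nil hu1
  obtain ⟨U', q, hU'⟩ := (List.eq_nil_or_concat _).resolve_left hu1
  rw [List.concat_eq_append] at hU'
  -- The word `u y v y⁻¹` is cyclically reduced once `y` is foreign to `v`, differs from the first
  -- letter of `u` and is not inverse to its last. These exclude at most two of `a^±1`, `b^±1`.
  obtain ⟨y, hy, hyp, hyq⟩ : ∃ y : α × Bool, (∀ e, (y.1, e) ∉ v.toWord) ∧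
      (p.1 = y.1 → p.2 ≠ y.2) ∧ (q.1 = y.1 → q.2 = y.2) := by
    by_cases h1 : p.1 = a
    · by_cases h2 : q.1 = b
      · exact ⟨(b, q.2), hb, fun h => absurd (h1.symm.trans h) hab, fun _ => rfl⟩
      · exact ⟨(b, true), hb, fun h => absurd (h1.symm.trans h) hab, fun h => absurd h h2⟩
    · by_cases h2 : q.1 = a
      · exact ⟨(a, q.2), ha, fun h => absurd h h1, fun _ => rfl⟩
      · exact ⟨(a, true), ha, fun h => absurd h h1, fun h => absurd h h2⟩
  have hW : IsReduced (u.toWord ++ (y :: (v.toWord ++ [(y.1, !y.2)]))) := by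
    have hvr := isReduced_toWord (x := v)
    have hur := isReduced_toWord (x := u)
    simp only [IsReduced] at hvr hur ⊢
    rw [List.isChain_append, List.isChain_cons, List.isChain_append]
    refine ⟨hur, ⟨fun z hz h => ?_, hvr, by simp, fun z hz w hw h => ?_⟩, fun z hz w hw h => ?_⟩
    · rw [List.head?_append_of_ne_nil _ hv1] at hz
      exact absurd (h ▸ List.mem_of_mem_head? hz : (y.1, z.2) ∈ v.toWord) (hy _)
    · simp only [List.head?_cons, Option.mem_def, Option.some.injEq] at hw
      subst hw
      have hm := List.mem_of_mem_getLast? hz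
      exact absurd (by rw [← h]; exact hm : (y.1, z.2) ∈ v.toWord) (hy _)
    · simp only [hU', List.getLast?_concat, List.head?_cons, Option.mem_def,
        Option.some.injEq] at hz hw
      subst hz hw
      exact hyq h
  have hword : (u * (mk [y] * v * (mk [y])⁻¹)).toWord =
      u.toWord ++ (y :: (v.toWord ++ [(y.1, !y.2)])) := by
    rw [← hW.reduce_eq, ← toWord_mk]
    congr 1
    conv_lhs => rw [← mk_toWord (x := u), ← mk_toWord (x := v), inv_mk, mul_mk, mul_mk, mul_mk]
    simp [invRev]
  have hcyc : IsCyclicallyReduced (u * (mk [y] * v * (mk [y])⁻¹)).toWord := by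
    rw [hword, isCyclicallyReduced_iff]
    refine ⟨hW, fun z hz w hw h => ?_⟩
    rw [hU] at hw
    rw [← List.cons_append, ← List.append_assoc, List.getLast?_concat] at hz
    simp only [List.cons_append, List.head?_cons, Option.mem_def, Option.some.injEq] at hz hw
    subst hz hw
    have := hyp h.symm
    revert this
    cases y.2 <;> cases p.2 <;> simp
  refine ⟨mk [y], fun x hx => ?_⟩
  obtain ⟨e, he⟩ : ∃ e, (x, e) ∈ u.toWord ++ (y :: (v.toWord ++ [(y.1, !y.2)])) := by
    rcases hx with hx | hx <;> obtain ⟨e, he⟩ := hx.mem_toWord <;> exact ⟨e, by simp [he]⟩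
  exact occurs_of_mem_toWord hcyc (hword ▸ he)

end FreeGroup

/-! ### Moves derived from (T1), (T2), (T3C) -/

open FreeGroup Function

/-- Reachability by (T1), (T2) and (T3C). -/
abbrev CyclicReach {n m : ℕ} : WordTuple n m → WordTuple n m → Prop :=
  Relation.ReflTransGen fun V W => NielsenStep V W ∨ CyclicStep V W

namespace CyclicReach

variable {n m : ℕ} (W : WordTuple n m)

theorem inv (i : Fin n) : CyclicReach W (update W i (W i)⁻¹) :=
  .single (.inl (.inv W i))

theorem mul {i j : Fin n} (hij : i ≠ j) : CyclicReach W (update W i (W i * W j)) :=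
  .single (.inl (.mul W i j hij))

theorem rotate (i : Fin n) {L : List (Fin m × Bool)} (hL : (W i).toWord.IsRotated L) :
    CyclicReach W (update W i (mk L)) :=
  .single (.inr (.rotate W i L hL))

theorem mul_inv {i j : Fin n} (hij : i ≠ j) : CyclicReach W (update W i (W i * (W j)⁻¹)) := by
  refine ((inv W j).trans (mul _ hij)).trans ?_
  convert inv _ j using 1
  ext l
  by_cases hi : l = i <;> by_cases hj : l = j <;> simp_all [update_apply]

theorem mul_left {i j : Fin n} (hij : i ≠ j) : CyclicReach W (update W i (W j * W i)) := by
  refine ((inv W i).trans (mul_inv _ hij)).trans ?_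
  convert inv _ i using 1
  simp [hij.symm]

theorem mul_inv_left {i j : Fin n} (hij : i ≠ j) :
    CyclicReach W (update W i ((W j)⁻¹ * W i)) := by
  refine ((inv W i).trans (mul _ hij)).trans ?_
  convert inv _ i using 1
  simp [hij.symm]

theorem mul_pow {i j : Fin n} (hij : i ≠ j) (k : ℕ) :
    CyclicReach W (update W i (W i * W j ^ k)) := by
  induction k with
  | zero => simpa using Relation.ReflTransGen.refl
  | succ k ih =>
    refine ih.trans ?_
    convert mul _ hij using 1
    simp [hij.symm, pow_succ, mul_assoc]

theorem mul_pow_inv {i j : Fin n} (hij : i ≠ j) (k : ℕ) :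
    CyclicReach W (update W i (W i * (W j ^ k)⁻¹)) := by
  induction k with
  | zero => simpa using Relation.ReflTransGen.refl
  | succ k ih =>
    refine ih.trans ?_
    convert mul_inv _ hij using 1
    simp [hij.symm, pow_succ', mul_assoc]

theorem swap (i j : Fin n) : CyclicReach W (W ∘ Equiv.swap i j) := by
  by_cases hij : i = j
  · subst hij
    simpa using Relation.ReflTransGen.refl
  refine (mul W hij).trans ((inv _ j).trans ((mul_left _ (Ne.symm hij)).trans
    ((inv _ i).trans ((mul _ hij).trans ?_))))
  convert inv _ i using 1
  ext l
  have hji : j ≠ i := Ne.symm hij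
  by_cases hi : l = i <;> by_cases hj : l = j <;>
    simp_all [Equiv.swap_apply_of_ne_of_ne]

theorem comp_perm (σ : Equiv.Perm (Fin n)) : CyclicReach W (W ∘ σ) := by
  induction σ using Equiv.Perm.swap_induction_on' with
  | one => exact Relation.ReflTransGen.refl
  | mul_swap f x y _ ih => exact ih.trans (swap (W ∘ f) x y)

theorem inv_of_forall {V : WordTuple n m} (h : ∀ i, V i = W i ∨ V i = (W i)⁻¹) :
    CyclicReach W V := by
  classical
  have key : ∀ s : Finset (Fin n), CyclicReach W fun i => if i ∈ s then V i else W i := by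
    intro s
    induction s using Finset.induction_on with
    | empty => simpa using Relation.ReflTransGen.refl
    | insert a s ha ih =>
      refine ih.trans ?_
      rcases h a with h | h
      · convert Relation.ReflTransGen.refl using 1
        ext i
        by_cases hi : i = a <;> simp_all
      · convert inv _ a using 1
        ext i
        by_cases hi : i = a <;> simp_all
  simpa using key Finset.univ

theorem rotate_isRotated {i : Fin n} {L L' : List (Fin m × Bool)} (hi : W i = mk L)
    (hL : IsReduced L) (h : L.IsRotated L') : CyclicReach W (update W i (mk L')) := by
  refine rotate W i ?_
  rwa [hi, toWord_mk, hL.reduce_eq]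

theorem exists_isCyclicallyReduced :
    ∃ V : WordTuple n m, CyclicReach W V ∧ ∀ i, IsConj (W i) (V i) ∧
      IsCyclicallyReduced (V i).toWord := by
  classical
  have key : ∀ s : Finset (Fin n),
      CyclicReach W fun i => if i ∈ s then cyclicReduction (W i) else W i := by
    intro s
    induction s using Finset.induction_on with
    | empty => simpa using Relation.ReflTransGen.refl
    | insert a s ha ih =>
      refine ih.trans ?_
      obtain ⟨L, hL, hL'⟩ := exists_isRotated_cyclicReduction (W a)
      convert rotate (fun i => if i ∈ s then cyclicReduction (W i) else W i) a (L := L)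
        (by simpa [ha] using hL) using 1
      ext i
      by_cases hi : i = a <;> simp_all
  exact ⟨fun i => cyclicReduction (W i), by simpa using key Finset.univ, fun i =>
    ⟨isConj_cyclicReduction _, isCyclicallyReduced_cyclicReduction _⟩⟩

/-- If the word of `W k` ends with a letter, then rows `i` and `k` can be conjugated by it
simultaneously. -/
theorem conj_pair_of_getLast? {i k : Fin n} (hik : i ≠ k) {l : Fin m × Bool}
    (hl : (W k).toWord.getLast? = some l) :
    CyclicReach W (update (update W i (mk [l] * W i * (mk [l])⁻¹)) k
      (mk [l] * W k * (mk [l])⁻¹)) := by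
  have rot : ∀ w : FreeGroup (Fin m), w.toWord.getLast? = some l →
      ∃ L, w.toWord.IsRotated L ∧ mk L = mk [l] * w * (mk [l])⁻¹ := by
    intro w hw
    obtain ⟨L, hL⟩ := List.getLast?_eq_some_iff.1 hw
    refine ⟨l :: L, ?_, ?_⟩
    · rw [hL]
      exact List.isRotated_concat l L
    · rw [← mk_toWord (x := w), hL, ← mul_mk, ← mul_assoc, mul_inv_cancel_right, mul_mk]
      rfl
  -- With `N` copies of row `k` appended, row `i` also ends in `l`, so one rotation conjugates each
  -- row by `l`. The copies, now conjugated as well, are then removed.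
  obtain ⟨N, hN⟩ := exists_getLast?_toWord_mul_pow hl (W i)
  obtain ⟨L₁, h₁, e₁⟩ := rot _ hN
  obtain ⟨L₂, h₂, e₂⟩ := rot _ hl
  refine (mul_pow W hik N).trans ((rotate _ i (L := L₁) (by simpa using h₁)).trans
    ((rotate _ k (L := L₂) (by simpa [hik.symm] using h₂)).trans ?_))
  convert mul_pow_inv _ hik N using 1
  rw [e₁, e₂]
  generalize mk [l] = c
  ext x
  by_cases hi : x = i
  · subst hi
    simp only [update_self, update_of_ne hik, conj_pow]
    group
  · by_cases hk : x = k <;> simp_all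

/-- A row can be conjugated by any letter that occurs in another, cyclically reduced, row. -/
theorem conj_letter {i k : Fin n} (hik : i ≠ k) (hk : IsCyclicallyReduced (W k).toWord)
    {x : Fin m} {e : Bool} (hx : (x, e) ∈ (W k).toWord) (d : Bool) :
    CyclicReach W (update W i (mk [(x, d)] * W i * (mk [(x, d)])⁻¹)) := by
  have key : ∀ W : WordTuple n m, IsCyclicallyReduced (W k).toWord → (x, d) ∈ (W k).toWord →
      CyclicReach W (update W i (mk [(x, d)] * W i * (mk [(x, d)])⁻¹)) := by
    intro W hk hx
    obtain ⟨A, B, hAB⟩ := List.append_of_mem hx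
    have r₁ : (W k).toWord.IsRotated (B ++ A ++ [(x, d)]) := by
      rw [hAB, List.append_assoc, List.append_cons]
      exact List.isRotated_append
    have c₁ := (hk.isRotated r₁).isReduced
    have c₂ := (hk.isRotated (r₁.trans (List.isRotated_concat _ _))).isReduced
    refine (rotate W k r₁).trans ?_
    refine (conj_pair_of_getLast? _ hik (l := (x, d)) ?_).trans ?_
    · rw [update_self, toWord_mk, c₁.reduce_eq, List.getLast?_concat]
    · convert rotate_isRotated _ (i := k) (L := (x, d) :: (B ++ A)) ?_ c₂
        (r₁.trans (List.isRotated_concat _ _)).symm using 1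
      · ext y
        by_cases hy : y = k
        · subst hy
          simp [hik.symm, mk_toWord]
        · by_cases hi : y = i <;> simp_all [update_apply]
      · rw [update_self, update_self, ← mul_mk, ← mul_assoc, mul_inv_cancel_right, mul_mk]
        rfl
  by_cases hd : e = d
  · exact key W hk (hd ▸ hx)
  · have hd' : (!e) = d := by cases e <;> cases d <;> simp_all
    refine (inv W k).trans ((key _ ?_ ?_).trans ?_)
    · rw [update_self, isCyclicallyReduced_iff_append_self, toWord_inv, ← invRev_append]
      rw [isReduced_iff_reduce_eq, reduce_invRev,
        (isCyclicallyReduced_iff_append_self.1 hk).reduce_eq]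
    · rw [update_self, toWord_inv, ← hd']
      simp only [invRev, List.mem_reverse, List.mem_map]
      exact ⟨(x, e), hx, rfl⟩
    · convert inv _ k using 1
      ext y
      by_cases hy : y = k <;> by_cases hi : y = i <;> simp_all [update_apply]

/-- A row can be conjugated by any element if every letter occurs in some other, cyclically
reduced, row. -/
theorem conj {k : Fin n}
    (hk : ∀ x, ∃ l ≠ k, IsCyclicallyReduced (W l).toWord ∧ Occurs x (W l))
    (s : FreeGroup (Fin m)) : CyclicReach W (update W k (s * W k * s⁻¹)) := by
  rw [← mk_toWord (x := s)]
  induction s.toWord with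
  | nil => simpa [← one_eq_mk] using Relation.ReflTransGen.refl
  | cons p L ih =>
    refine ih.trans ?_
    obtain ⟨l, hl, hc, ho⟩ := hk p.1
    obtain ⟨e, he⟩ := ho.mem_toWord
    convert conj_letter (update W k (mk L * W k * (mk L)⁻¹)) hl.symm (x := p.1) (e := e)
      (by simpa [hl] using hc) (by simpa [hl] using he) p.2 using 1
    have hmk : mk (p :: L) = mk [p] * mk L := by simp
    simp [hmk, mul_assoc, -mul_mk, -inv_mk]

end CyclicReach


/-! ### The abelianised invariant -/

/-- Every homomorphism to a commutative group that kills all entries of `R` is trivial. -/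
def AbelianisesTrivially {n m : ℕ} (R : WordTuple n m) : Prop :=
  ∀ (A : Type) [CommGroup A] (f : FreeGroup (Fin m) →* A), (∀ i, f (R i) = 1) → f = 1

namespace AbelianisesTrivially

variable {n m : ℕ} {R V : WordTuple n m}

theorem of_isConj (hR : AbelianisesTrivially R) (h : ∀ i, IsConj (R i) (V i)) :
    AbelianisesTrivially V := fun A _ f hf =>
  hR A f fun i => (isConj_iff_eq.1 (f.map_isConj (h i))).trans (hf i)

theorem of_inv {i : Fin n} (hR : AbelianisesTrivially (update R i (R i)⁻¹)) :
    AbelianisesTrivially R := fun A _ f hf => hR A f fun l => by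
  by_cases hl : l = i
  · subst hl
    simp [hf]
  · simp [hl, hf]

theorem of_mul {i j : Fin n} (hR : AbelianisesTrivially (update R i (R i * R j))) :
    AbelianisesTrivially R := fun A _ f hf => hR A f fun l => by
  by_cases hl : l = i
  · subst hl
    simp [hf]
  · simp [hl, hf]

theorem exists_occurs (hR : AbelianisesTrivially R) (x : Fin m) : ∃ i, Occurs x (R i) := by
  by_contra! h
  have : expSum x = 1 := hR _ _ fun i => by
    by_contra hi
    exact h i (occurs_of_expSum_ne_one hi)
  exact expSum_of_self_ne_one x (by rw [this]; rfl)

end AbelianisesTrivially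

theorem letterTuple_abelianisesTrivially (m : ℕ) : AbelianisesTrivially (letterTuple m) :=
  fun _ _ _ hf => FreeGroup.ext_hom _ _ hf

theorem FreeGroup.exists_zpow_of_forall_occurs {α : Type*} [DecidableEq α] {w : FreeGroup α}
    (hw : IsCyclicallyReduced w.toWord) {x : α} (h : ∀ y, Occurs y w → y = x) :
    ∃ z : ℤ, of x ^ z = w := by
  refine Subgroup.mem_zpowers_iff.1 (mem_of_forall_mem_toWord fun p hp => ?_)
  rw [h p.1 (occurs_of_mem_toWord hw (e := p.2) hp)]
  exact Subgroup.mem_zpowers _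

/-! ### Reaching the letters, and multiplying by a conjugate -/

namespace CyclicReach

variable {m : ℕ}

theorem letterTuple_of_isConj {W : WordTuple m m} (h : ∀ i, IsConj (letterTuple m i) (W i)) :
    CyclicReach W (letterTuple m) := by
  obtain ⟨V, hWV, hV⟩ := exists_isCyclicallyReduced W
  convert hWV
  ext1 i
  have hc := (h i).trans (hV i).1
  obtain ⟨z, hz⟩ := exists_zpow_of_forall_occurs (hV i).2 (x := i) fun y hy => by
    obtain ⟨e, he⟩ := (hy.of_isConj hc.symm).mem_toWord
    simp only [letterTuple, toWord_of, List.mem_singleton, Prod.mk.injEq] at he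
    exact he.1
  have he := isConj_iff_eq.1 ((expSum i).map_isConj hc)
  rw [← hz, letterTuple, map_zpow, expSum_of, if_pos rfl, ← ofAdd_zsmul] at he
  have h1 : (1 : ℤ) = z := by simpa using he
  rw [← hz, ← h1, zpow_one]
  rfl

/-- If each row has a letter that occurs in no other row, then the rows are the letters up to
order and inversion. -/
theorem letterTuple_of_private_letters {V : WordTuple m m} (hV : AbelianisesTrivially V)
    (hc : ∀ i, IsCyclicallyReduced (V i).toWord)
    (h : ∀ k, ∃ x, ∀ l ≠ k, ¬ Occurs x (V l)) : CyclicReach V (letterTuple m) := by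
  choose c hcl using h
  -- A letter private to two rows would occur in no row at all.
  have hinj : Injective c := by
    intro k k' hkk
    by_contra hne
    obtain ⟨l, hl⟩ := hV.exists_occurs (c k)
    by_cases hlk : l = k
    · exact hcl k' l (by rintro rfl; exact hne hlk.symm) (hkk ▸ hl)
    · exact hcl k l hlk hl
  have hbij : Bijective c := Finite.injective_iff_bijective.1 hinj
  have hz : ∀ k, ∃ z : ℤ, of (c k) ^ z = V k := fun k =>
    exists_zpow_of_forall_occurs (hc k) fun y hy => by
      obtain ⟨l, rfl⟩ := hbij.2 y
      by_contra hne
      exact hcl l k (by rintro rfl; exact hne rfl) hy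
  choose z hz using hz
  have hunit : ∀ k, z k = 1 ∨ z k = -1 := by
    intro k
    -- Modulo `z k`, the exponent sum of `c k` kills every row, so `ZMod |z k|` is trivial; `z k =
    -- 0` is excluded too, as it would give `ℤ`.
    let f : FreeGroup (Fin m) →* Multiplicative (ZMod (z k).natAbs) :=
      lift fun y => Multiplicative.ofAdd (if y = c k then 1 else 0)
    have hf : f = 1 := hV _ f fun l => by
      rw [← hz l, map_zpow]
      by_cases hl : l = k
      · subst hl
        simp only [f, lift_apply_of, if_true, ← ofAdd_zsmul, zsmul_eq_mul, mul_one]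
        rw [ofAdd_eq_one, ZMod.intCast_zmod_eq_zero_iff_dvd]
        exact Int.natAbs_dvd.2 dvd_rfl
      · simp [f, hinj.eq_iff, hl]
    have h1 : f (of (c k)) = 1 := by rw [hf]; rfl
    simp only [f, lift_apply_of, if_true, ofAdd_eq_one] at h1
    have h2 : (z k).natAbs = 1 := by
      have h3 : ((1 : ℕ) : ZMod (z k).natAbs) = 0 := by simpa using h1
      exact Nat.dvd_one.1 ((ZMod.natCast_eq_zero_iff _ _).1 h3)
    exact Int.natAbs_eq_iff.1 h2
  have hsign : CyclicReach V (letterTuple m ∘ Equiv.ofBijective c hbij) :=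
    inv_of_forall V fun k => by
      rw [← hz k]
      rcases hunit k with h | h <;> simp [h, letterTuple]
  refine hsign.trans ?_
  convert comp_perm _ (Equiv.ofBijective c hbij)⁻¹ using 1
  ext1 x
  exact congrArg _ (Equiv.apply_symm_apply (Equiv.ofBijective c hbij) x).symm

theorem set_isConj {n : ℕ} (W : WordTuple n m) {k : Fin n}
    (hk : ∀ x, ∃ l ≠ k, IsCyclicallyReduced (W l).toWord ∧ Occurs x (W l))
    {w : FreeGroup (Fin m)} (h : IsConj (W k) w) : CyclicReach W (update W k w) := by
  obtain ⟨s, rfl⟩ := isConj_iff.1 h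
  exact conj W hk s

/-- Row `i` of a cyclically reduced tuple can be multiplied by any conjugate of row `j`, up to
conjugation of the rows. -/
theorem exists_mul_conj {V : WordTuple m m} (hV : AbelianisesTrivially V)
    (hc : ∀ i, IsCyclicallyReduced (V i).toWord) {i j : Fin m} (hij : i ≠ j)
    (h : FreeGroup (Fin m))
    (hT : AbelianisesTrivially (update V i (V i * (h * V j * h⁻¹)))) :
    CyclicReach V (letterTuple m) ∨ ∃ U, CyclicReach V U ∧
      ∀ l, IsConj (update V i (V i * (h * V j * h⁻¹)) l) (U l) := by
  by_cases hi : ∀ x, ∃ l ≠ i, Occurs x (V l)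
  · right
    refine ⟨_, (conj V (k := i) (fun x => ?_) h⁻¹).trans (mul _ hij), fun l => ?_⟩
    · obtain ⟨l, hl, hx⟩ := hi x
      exact ⟨l, hl, hc l, hx⟩
    · by_cases hl : l = i
      · subst hl
        simp only [update_self, update_of_ne hij.symm]
        exact isConj_iff.2 ⟨h⁻¹, by group⟩
      · rw [update_of_ne hl, update_of_ne hl, update_of_ne hl]
  by_cases hj : ∀ x, ∃ l ≠ j, Occurs x (V l)
  · right
    refine ⟨_, (conj V (k := j) (fun x => ?_) h).trans (mul _ hij), fun l => ?_⟩
    · obtain ⟨l, hl, hx⟩ := hj x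
      exact ⟨l, hl, hc l, hx⟩
    · by_cases hl : l = i
      · subst hl
        rw [update_self, update_self, update_self, update_of_ne hij]
      · by_cases hl' : l = j
        · subst hl'
          rw [update_of_ne hl, update_of_ne hl, update_self]
          exact isConj_iff.2 ⟨h, rfl⟩
        · rw [update_of_ne hl, update_of_ne hl, update_of_ne hl']
  by_cases hk : ∀ k, ∃ x, ∀ l ≠ k, ¬ Occurs x (V l)
  · exact .inl (letterTuple_of_private_letters hV hc hk)
  right
  push Not at hi hj hk
  obtain ⟨k, hk⟩ := hk
  obtain ⟨a, ha⟩ := hi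
  obtain ⟨b, hb⟩ := hj
  have hki : k ≠ i := by
    rintro rfl
    obtain ⟨l, hl, hx⟩ := hk a
    exact ha l hl hx
  have hkj : k ≠ j := by
    rintro rfl
    obtain ⟨l, hl, hx⟩ := hk b
    exact hb l hl hx
  have hab : a ≠ b := by
    rintro rfl
    obtain ⟨l, hx⟩ := hV.exists_occurs a
    by_cases hl : l = i
    · exact hb l (hl ▸ hij) hx
    · exact ha l hl hx
  obtain ⟨s, hs⟩ := exists_occurs_mul_conj (u := V i * (h * V j * h⁻¹)) (v := V k) hab
    (fun e he => ha k hki (occurs_of_mem_toWord (hc k) he))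
    (fun e he => hb k hkj (occurs_of_mem_toWord (hc k) he))
  -- Chosen so that multiplying row `i` by `X` gives the target row times `s V_k s⁻¹`, with `s`
  -- preventing any loss of letters.
  set Z := h⁻¹ * s * V k * (h⁻¹ * s)⁻¹ with hZ
  set X := h * (V j * Z) * h⁻¹ with hX
  have hIX : V i * X = V i * (h * V j * h⁻¹) * (s * V k * s⁻¹) := by
    rw [hX, hZ]
    group
  rw [← hIX] at hs
  obtain ⟨L, hL, hL'⟩ := exists_isRotated_cyclicReduction (V i * X)
  obtain ⟨d, hd⟩ := isConj_iff.1 (isConj_cyclicReduction (V i * X))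
  set D := cyclicReduction (V i * X) with hD
  have cover : ∀ w x, ∃ l ≠ k, IsCyclicallyReduced (update V k w l).toWord ∧
      Occurs x (update V k w l) := fun w x => by
    obtain ⟨l, hl, hx⟩ := hk x
    exact ⟨l, hl, by simpa [hl] using hc l, by simpa [hl] using hx⟩
  -- Row `k` stays free: `D` keeps all letters of the target row `i` and of `V k`, and each letter
  -- occurs somewhere in the target tuple.
  have cover' : ∀ w x, ∃ l ≠ k,
      IsCyclicallyReduced (update (update V i D) k w l).toWord ∧
      Occurs x (update (update V i D) k w l) := fun w x => by
    have hDx : Occurs x (V i * (h * V j * h⁻¹)) ∨ Occurs x (V k) →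
        ∃ l ≠ k, IsCyclicallyReduced (update (update V i D) k w l).toWord ∧
          Occurs x (update (update V i D) k w l) := fun hx => by
      refine ⟨i, hki.symm, ?_⟩
      rw [update_of_ne hki.symm, update_self]
      exact ⟨isCyclicallyReduced_cyclicReduction _,
        (hs x hx).of_isConj (isConj_cyclicReduction _)⟩
    obtain ⟨l, hx⟩ := hT.exists_occurs x
    by_cases hli : l = i
    · subst hli
      exact hDx (.inl (by simpa using hx))
    · rw [update_of_ne hli] at hx
      by_cases hlk : l = k
      · exact hDx (.inr (hlk ▸ hx))
      · exact ⟨l, hlk, by simpa [hlk, hli] using hc l, by simpa [hlk, hli] using hx⟩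
  have r₁ : CyclicReach V (update V k X) := by
    have c₁ : CyclicReach V (update V k Z) :=
      conj V (by simpa using cover (V k)) (h⁻¹ * s)
    have c₂ : CyclicReach (update V k Z) (update V k (V j * Z)) := by
      simpa [hkj.symm] using mul_left (update V k Z) hkj
    have c₃ : CyclicReach (update V k (V j * Z)) (update V k X) := by
      simpa using conj (update V k (V j * Z)) (cover _) h
    exact (c₁.trans c₂).trans c₃
  have r₂ : CyclicReach (update V k X) (update (update V i D) k X) := by
    have c₁ := mul (update V k X) hki.symm
    rw [update_self, update_of_ne hki.symm] at c₁
    have c₂ := rotate (update (update V k X) i (V i * X)) i (L := L) (by simpa using hL)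
    rw [update_idem, hL'] at c₂
    rw [update_comm hki.symm]
    exact c₁.trans c₂
  -- Row `j` is stripped from row `k`, leaving the conjugate of `V k` that cancels the surplus
  -- factor in `D`.
  have r₃ : CyclicReach (update (update V i D) k X)
      (update (update V i D) k (d * (s * V k * s⁻¹) * d⁻¹)) := by
    have c₁ := set_isConj (update (update V i D) k X) (cover' _) (w := V j * Z)
      (isConj_iff.2 ⟨h⁻¹, by rw [update_self, hX]; group⟩)
    have c₂ := mul_inv_left (update (update V i D) k (V j * Z)) hkj
    have c₃ := set_isConj (update (update V i D) k Z) (cover' _)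
      (w := d * (s * V k * s⁻¹) * d⁻¹)
      (isConj_iff.2 ⟨d * h, by rw [update_self, hZ]; group⟩)
    rw [update_idem] at c₁ c₃
    rw [update_idem, update_self, update_of_ne hkj.symm, update_of_ne hij.symm,
      inv_mul_cancel_left] at c₂
    exact (c₁.trans c₂).trans c₃
  refine ⟨_, ((r₁.trans r₂).trans r₃).trans (mul_inv _ hki.symm), fun l => ?_⟩
  by_cases hli : l = i
  · subst hli
    rw [update_self, update_self, update_self, update_of_ne hki.symm, update_self, ← hd, hIX]
    exact isConj_iff.2 ⟨d, by group⟩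
  · rw [update_of_ne hli, update_of_ne hli]
    by_cases hlk : l = k
    · subst hlk
      rw [update_self]
      exact isConj_iff.2 ⟨d * s, by group⟩
    · rw [update_of_ne hlk, update_of_ne hli]

end CyclicReach

/-- Conjugations can be traded for cyclic permutations. -/
theorem IsACTrivialisable.isCyclicallyACTrivialisable {m : ℕ} {R : WordTuple m m}
    (hR : IsACTrivialisable R) : IsCyclicallyACTrivialisable R := by
  -- Quantifying over all rowwise conjugates makes (T3) steps vacuous.
  have key : AbelianisesTrivially R ∧
      ∀ W : WordTuple m m, (∀ i, IsConj (R i) (W i)) → CyclicReach W (letterTuple m) := by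
    induction hR using Relation.ReflTransGen.head_induction_on with
    | refl =>
      exact ⟨letterTuple_abelianisesTrivially m, fun W => CyclicReach.letterTuple_of_isConj⟩
    | @head R _ hstep _ ih =>
      obtain ⟨hab, ih⟩ := ih
      rcases hstep with (⟨i⟩ | ⟨i, j, hij⟩) | ⟨i, s⟩
      · refine ⟨hab.of_inv, fun W hW => (CyclicReach.inv W i).trans (ih _ fun l => ?_)⟩
        by_cases hl : l = i
        · subst hl
          obtain ⟨g, hg⟩ := isConj_iff.1 (hW l)
          exact isConj_iff.2 ⟨g, by simp [← hg, mul_assoc]⟩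
        · simpa [hl] using hW l
      · refine ⟨hab.of_mul, fun W hW => ?_⟩
        obtain ⟨V, hWV, hV⟩ := CyclicReach.exists_isCyclicallyReduced W
        have hRV : ∀ l, IsConj (R l) (V l) := fun l => (hW l).trans (hV l).1
        obtain ⟨g, hg⟩ := isConj_iff.1 (hRV i)
        obtain ⟨k, hk⟩ := isConj_iff.1 (hRV j)
        have hT : ∀ l, IsConj (update R i (R i * R j) l)
            (update V i (V i * (g * k⁻¹ * V j * (g * k⁻¹)⁻¹)) l) := fun l => by
          by_cases hl : l = i
          · subst hl
            rw [update_self, update_self, ← hg, ← hk]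
            exact isConj_iff.2 ⟨g, by group⟩
          · simpa [hl] using hRV l
        rcases CyclicReach.exists_mul_conj (hab.of_mul.of_isConj hRV) (fun l => (hV l).2) hij
          (g * k⁻¹) (hab.of_isConj hT) with h | ⟨U, hU, hUc⟩
        · exact hWV.trans h
        · exact (hWV.trans hU).trans (ih U fun l => (hT l).trans (hUc l))
      · have hc : ∀ l, IsConj (update R i (s * R i * s⁻¹) l) (R l) := fun l => by
          by_cases hl : l = i
          · subst hl
            simpa using (isConj_iff.2 ⟨s, rfl⟩ : IsConj (R l) _).symm
          · rw [update_of_ne hl]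
        exact ⟨hab.of_isConj hc, fun W hW => ih W fun l => (hc l).trans (hW l)⟩
  exact key.2 R fun _ => IsConj.refl _

theorem corollary3 :
    (∀ R : WordTuple 2 2, IsACTrivialisable R → IsCyclicallyACTrivialisable R) ∧
    (∀ r : ℕ, 2 ≤ r →
      (∀ m : ℕ, 2 ≤ m → m ≤ r →
        ∀ R : WordTuple m m, DefinesTrivialGroup R → IsACTrivialisable R) →
      ∀ m : ℕ, 2 ≤ m → m ≤ r →
        ∀ R : WordTuple m m, DefinesTrivialGroup R → IsCyclicallyACTrivialisable R) :=
  ⟨fun _ hR => hR.isCyclicallyACTrivialisable, fun _ _ h m hm hmr R hR =>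
    (h m hm hmr R hR).isCyclicallyACTrivialisable⟩
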